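/- Let $d\ge 1$ be an integer and let $D,B,\alpha>0$ satisfy $B/\alpha\ge D/8$. Let $\mathbb{X}_2(D)$ be the collection of nonempty closed convex sets $\mathcal{X}\subseteq\mathbb{R}^d$ with $\|x-y\|_2\le D$ for all $x,y\in\mathcal{X}$. For $\mathcal{X}\in\mathbb{X}_2(D)$ let $\mathcal{O}_{\mathrm{sc}}$ be the class of all pairs $(f,O)$ in which $f:\mathcal{X}\to\mathbb{R}$ is convex, $f-\frac{\alpha}{2}\|\cdot\|_2^2$ is convex on $\mathcal{X}$, and $O$ is a stochastic first-order oracle: a query at $x\in\mathcal{X}$ is answered by a fresh random draw $\hat g(x)\in\mathbb{R}^d$ from a distribution $O(\cdot\mid x)$ such that $\mathbb{E}[\hat g(x)]$ is a subgradient of $f$ at $x$ (that is, $f(y)\ge f(x)+\langle \mathbb{E}[\hat g(x)],y-x\rangle$ for all $y\in\mathcal{X}$) and $\|\hat g(x)\|_2^2\le B^2$ almost surely. An oblivious sampling channel is given by a probability vector $(p_i)_{i\in[d]}$: on input $g\in\mathbb{R}^d$ it outputs $g(i)e_i$ with probability $p_i$, where $e_1,\dots,e_d$ is the standard basis. Let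 $\mathcal{W}_{\mathrm{obl}}$ be the set of all these channels. An optimization algorithm $\pi$ with $T$ queries interacts with the oracle as follows: for each query it chooses a point of $\mathcal{X}$ as a function of its private randomness and of all earlier channel outputs; the oracle's answer is passed through a channel of $\mathcal{W}_{\mathrm{obl}}$, which an adaptive channel selection strategy $S$ chooses as a function of the earlier channel outputs; and the algorithm observes only the channel output. After the $T$ queries it outputs a point $x_T\in\mathcal{X}$, a function of its private randomness and of the $T$ channel outputs. The adaptive minmax optimization error is $$\mathcal{E}^*(\mathcal{X},\mathcal{O}_{\mathrm{sc}},T,\mathcal{W}_{\mathrm{obl}})=\inf_{\pi}\inf_{S}\sup_{(f,O)\in\mathcal{O}_{\mathrm{sc}}}\mathbb{E}\Big[f(x_T)-\min_{x\in\mathcal{X}}f(x)\Big].$$ Theorem. There exist absolute constants $c_0,c_1>0$ (independent of $d,D,B,\alpha,T$) such that for every positive integer $T\ge c_0\, d\,\frac{B^2}{\alpha^2D^2}$, $$\sup_{\mathcal{X}\in\mathbb{X}_2(D)}\mathcal{E}^*(\mathcal{X},\mathcal{O}_{\mathrm{sc}},T,\mathcal{W}_{\mathrm{obl}})\ \ge\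 \frac{c_1\,d\,B^2}{\alpha T}.$$ -/

import Mathlib

open MeasureTheory ProbabilityTheory
open scoped ENNReal

noncomputable section

namespace ConstrainedOpt

/-- `ℝ^d` with the Euclidean norm. -/
abbrev Vec (d : ℕ) : Type := EuclideanSpace ℝ (Fin d)

variable {d : ℕ}

/-- The domains `𝒳 ⊆ ℝ^d` whose Euclidean diameter is at most `D`. A domain of convex functions is
nonempty and convex; it is closed, hence compact, so that the maximum in the diameter and the
minima of continuous functions are attained. -/
def domains (d : ℕ) (D : ℝ) : Set (Set (Vec d)) :=
  {X | X.Nonempty ∧ IsClosed X ∧ Convex ℝ X ∧ ∀ x ∈ X, ∀ y ∈ X, ‖x - y‖ ≤ D}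

/-- The subgradients at `x` of a function `f` on `X`. -/
def subdifferential (X : Set (Vec d)) (f : Vec d → ℝ) (x : Vec d) : Set (Vec d) :=
  {g | ∀ y ∈ X, f x + inner ℝ g (y - x) ≤ f y}

/-- `f` is convex and `α`-strongly convex on `X`, and `O` is a stochastic first-order oracle for it:
a query at `x ∈ X` is answered by a draw from the distribution `O x`, whose mean is a subgradient
of `f` at `x` and whose Euclidean norm is almost surely at most `B`. The values of `f` outside `X`
play no role. -/
structure IsStronglyConvexPair (X : Set (Vec d)) (α B : ℝ) (f : Vec d → ℝ)
    (O : Kernel X (Vec d)) : Prop where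
  isMarkovKernel : IsMarkovKernel O
  convexOn : ConvexOn ℝ X f
  strongConvexOn : StrongConvexOn X α f
  unbiased : ∀ x : X, (∫ g, g ∂(O x)) ∈ subdifferential X f x
  bounded : ∀ x : X, ∀ᵐ g ∂(O x), ‖g‖ ^ 2 ≤ B ^ 2

/-- The class of all pairs of an `α`-strongly convex function and an oracle for it. -/
def stronglyConvexClass (X : Set (Vec d)) (α B : ℝ) : Set ((Vec d → ℝ) × Kernel X (Vec d)) :=
  {fO | IsStronglyConvexPair X α B fO.1 fO.2}

/-- Oblivious sampling channels: for a fixed probability vector `p`, the input `g` is mapped to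
`g i • e_i` with probability `p i`. -/
def obliviousChannels (d : ℕ) : Set (Kernel (Vec d) (Vec d)) :=
  {W | ∃ p : Fin d → ℝ, (∀ i, 0 ≤ p i) ∧ ∑ i, p i = 1 ∧
    ∀ g : Vec d, W g =
      ∑ i, ENNReal.ofReal (p i) • Measure.dirac (EuclideanSpace.single i (g i) : Vec d)}

/-- A (randomized) first-order optimization algorithm on `X`. It holds private randomness `u` with
law `μ`; after the channel outputs `y_0, …, y_{t-1}` its current point is
`point t (u, (y_0, …, y_{t-1})) ∈ X`. When it is run for `T` queries, the queries are its points at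
the times `0, …, T - 1` and the output is its point at the time `T`; the later points are
irrelevant. -/
structure Algorithm (X : Set (Vec d)) where
  Ω : Type
  [measurableSpace : MeasurableSpace Ω]
  μ : Measure Ω
  [isProbabilityMeasure : IsProbabilityMeasure μ]
  point : (t : ℕ) → Ω × (Fin t → Vec d) → X
  measurable_point : ∀ t, Measurable (point t)

attribute [instance] Algorithm.measurableSpace Algorithm.isProbabilityMeasure

/-- An adaptive channel selection strategy: the channel used at time `t` is a member of `𝒲` that is
chosen as a (measurable) function of the channel outputs at the times `0, …, t - 1`. Here
`chan t (h, g)` is the output distribution, at history `h`, for the input `g`. -/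
structure ChannelStrategy (𝒲 : Set (Kernel (Vec d) (Vec d))) where
  chan : (t : ℕ) → Kernel ((Fin t → Vec d) × Vec d) (Vec d)
  isMarkovKernel : ∀ t, IsMarkovKernel (chan t)
  mem : ∀ (t : ℕ) (h : Fin t → Vec d), (chan t).sectR h ∈ 𝒲

variable {X : Set (Vec d)} {𝒲 : Set (Kernel (Vec d) (Vec d))}

/-- The conditional distribution of the channel output at time `t`, given the private randomness
and the earlier outputs: the oracle draws `g` from `O x_t`, and `g` is passed through the channel
selected at time `t`. -/
def outputKernel (O : Kernel X (Vec d)) (A : Algorithm X) (S : ChannelStrategy 𝒲) (t : ℕ) :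
    Kernel (A.Ω × (Fin t → Vec d)) (Vec d) :=
  ((O.comap (A.point t) (A.measurable_point t)) ⊗ₖ
    ((S.chan t).comap (fun p : (A.Ω × (Fin t → Vec d)) × Vec d => (p.1.2, p.2))
      (by fun_prop))).snd

/-- The joint law of the private randomness and of the first `t` channel outputs. -/
def transcriptLaw (O : Kernel X (Vec d)) (A : Algorithm X) (S : ChannelStrategy 𝒲) :
    (t : ℕ) → Measure (A.Ω × (Fin t → Vec d))
  | 0 => A.μ.map (fun u => (u, Fin.elim0))
  | t + 1 => (transcriptLaw O A S t ⊗ₘ outputKernel O A S t).map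
      (fun p => (p.1.1, Fin.snoc (α := fun _ => Vec d) p.1.2 p.2))

/-- The expected optimality gap `𝔼[f(x_T) - min_X f]` after `T` queries. The gap is nonnegative,
so that its expectation is written as a Lebesgue integral with values in `[0, ∞]`. -/
def optError (f : Vec d → ℝ) (O : Kernel X (Vec d)) (A : Algorithm X) (S : ChannelStrategy 𝒲)
    (T : ℕ) : ℝ≥0∞ :=
  ∫⁻ ω, ENNReal.ofReal (f (A.point T ω) - ⨅ x : X, f x) ∂(transcriptLaw O A S T)

/-- The adaptive minmax optimization error over a class `𝒪` of pairs of functions and oracles,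
with `T` queries and with channels from the family `𝒲`. -/
def adaptiveMinmaxError (X : Set (Vec d)) (𝒪 : Set ((Vec d → ℝ) × Kernel X (Vec d))) (T : ℕ)
    (𝒲 : Set (Kernel (Vec d) (Vec d))) : ℝ≥0∞ :=
  ⨅ (A : Algorithm X) (S : ChannelStrategy 𝒲), ⨆ fO ∈ 𝒪, optError fO.1 fO.2 A S T

end ConstrainedOpt

end

/-! The hard functions are `α/2 ‖x - δ v‖²` on a small cube, one for each sign vector `v`. The
oracle returns `α x` plus independent noises `±b` of mean `-b η v i`; with `α δ = b η` its mean is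
the gradient. As `|α x i| < b`, the sign of a revealed coordinate is the sign of its noise, and `α x
i` is already known to the algorithm. So whatever is queried, a channel output carries one bit, of
bias of order `η`, about one coordinate of `v`, and the choice of that coordinate ignores the
answer.

The optimality gap is a sum of squared errors over the coordinates, so each coordinate is a
two-point test between `v` and `v` with one sign reversed. The indistinguishability of the two is
measured by the integral, under the unbiased reference law, of the harmonic mean of their likelihood
ratios. This affinity fits the squared loss exactly (`sq_mul_harmonicMean_le`), and revealing
coordinate `i` costs at most a fraction `η²` of the affinity of `i` and nothing for the others
(`harmonicMean_tilt_le`, `le_affinity_snoc`).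

Summed over `i`, the sampling probabilities add up to 1, so one query costs at most `2 η²` in total,
even when channels are chosen adaptively (`sum_affinity_le`, `card_le_sum_affinity`). If `4 T η² ≤
d`, half of the initial total `d` survives. Averaging over the hypercube
(`le_of_forall_sum_lintegral_le`) gives a squared error of at least `d δ² / 2`, hence a gap of at
least `α d δ² / 4`, of order `d B² / (α T)` when `η` is of order `√(d/T)` and `b` of order `B/√d`.
-/

noncomputable section

namespace ConstrainedOpt

variable {d : ℕ} {X : Set (Vec d)}

/-! ### Transcripts -/

section Transcript

variable {𝒲 : Set (Kernel (Vec d) (Vec d))}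

instance isMarkovKernel_chan (S : ChannelStrategy 𝒲) (t : ℕ) : IsMarkovKernel (S.chan t) :=
  S.isMarkovKernel t

instance isMarkovKernel_outputKernel (O : Kernel X (Vec d)) [IsMarkovKernel O] (A : Algorithm X)
    (S : ChannelStrategy 𝒲) (t : ℕ) : IsMarkovKernel (outputKernel O A S t) := by
  unfold outputKernel; infer_instance

lemma measurable_snoc_prod {Ω : Type*} [MeasurableSpace Ω] (t : ℕ) :
    Measurable (fun p : (Ω × (Fin t → Vec d)) × Vec d =>
      (p.1.1, Fin.snoc (α := fun _ => Vec d) p.1.2 p.2)) := by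
  refine Measurable.prodMk (by fun_prop) (measurable_pi_lambda _ fun i => ?_)
  refine Fin.lastCases ?_ (fun j => ?_) i
  · simp only [Fin.snoc_last]; fun_prop
  · simp only [Fin.snoc_castSucc]; fun_prop

instance isProbabilityMeasure_transcriptLaw (O : Kernel X (Vec d)) [IsMarkovKernel O]
    (A : Algorithm X) (S : ChannelStrategy 𝒲) (t : ℕ) :
    IsProbabilityMeasure (transcriptLaw O A S t) := by
  induction t with
  | zero =>
    exact Measure.isProbabilityMeasure_map (by fun_prop)
  | succ t ih =>
    exact Measure.isProbabilityMeasure_map (measurable_snoc_prod t).aemeasurable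

lemma lintegral_transcriptLaw_succ (O : Kernel X (Vec d)) [IsMarkovKernel O]
    (A : Algorithm X) (S : ChannelStrategy 𝒲) (t : ℕ)
    {F : A.Ω × (Fin (t + 1) → Vec d) → ℝ≥0∞} (hF : Measurable F) :
    ∫⁻ ω, F ω ∂(transcriptLaw O A S (t + 1)) =
      ∫⁻ ω, ∫⁻ y, F (ω.1, Fin.snoc (α := fun _ => Vec d) ω.2 y) ∂(outputKernel O A S t ω)
        ∂(transcriptLaw O A S t) := by
  rw [transcriptLaw, lintegral_map hF (measurable_snoc_prod t)]
  exact Measure.lintegral_compProd (hF.comp (measurable_snoc_prod t))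

/-- With an oblivious sampling channel, the channel output is `g i • e_i` for a coordinate `i`
whose distribution depends neither on the oracle nor on its answer `g`. -/
lemma exists_lintegral_outputKernel (A : Algorithm X) (S : ChannelStrategy (obliviousChannels d))
    (t : ℕ) (ω : A.Ω × (Fin t → Vec d)) :
    ∃ p : Fin d → ℝ, (∀ i, 0 ≤ p i) ∧ ∑ i, p i = 1 ∧
      ∀ (O : Kernel X (Vec d)) [IsMarkovKernel O] (G : Vec d → ℝ≥0∞), Measurable G →
        ∫⁻ y, G y ∂(outputKernel O A S t ω) =
          ∑ i, ENNReal.ofReal (p i) *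
            ∫⁻ g, G (EuclideanSpace.single i (g i)) ∂(O (A.point t ω)) := by
  obtain ⟨p, hp0, hp1, hp⟩ := S.mem t ω.2
  refine ⟨p, hp0, hp1, fun O _ G hG => ?_⟩
  have hsingle : ∀ i : Fin d,
      Measurable fun g : Vec d => (EuclideanSpace.single i (g i) : Vec d) := fun i => by
    have : Continuous fun g : Vec d => (EuclideanSpace.single i (g i) : Vec d) := by
      have h : (fun g : Vec d => (EuclideanSpace.single i (g i) : Vec d)) =
          fun g => g i • (EuclideanSpace.single i (1 : ℝ) : Vec d) := by
        ext g j; simp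
      rw [h]; fun_prop
    exact this.measurable
  rw [outputKernel, Kernel.lintegral_snd _ _ hG]
  refine (Kernel.lintegral_compProd _ _ _ (hG.comp measurable_snd)).trans ?_
  simp only [Kernel.comap_apply, Function.comp_apply]
  have h : ∀ g : Vec d, ∫⁻ y, G y ∂(S.chan t (ω.2, g)) =
      ∑ i, ENNReal.ofReal (p i) * G (EuclideanSpace.single i (g i)) := fun g => by
    have := hp g
    rw [Kernel.sectR_apply] at this
    rw [this, lintegral_finsetSum_measure]
    simp [lintegral_dirac' _ hG]
  simp only [h]
  refine (lintegral_finsetSum _ fun i _ => (hG.comp (hsingle i)).const_mul _).trans ?_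
  exact Finset.sum_congr rfl fun i _ => lintegral_const_mul _ (hG.comp (hsingle i))

end Transcript

/-! ### An oracle with a biased two-point noise -/

/-- The law on `{b, -b}` with mean `-(θ b)`. -/
def twoPoint (b θ : ℝ) : Measure ℝ :=
  ENNReal.ofReal ((1 - θ) / 2) • Measure.dirac b + ENNReal.ofReal ((1 + θ) / 2) • Measure.dirac (-b)

lemma isProbabilityMeasure_twoPoint (b : ℝ) {θ : ℝ} (hθ : |θ| ≤ 1) :
    IsProbabilityMeasure (twoPoint b θ) := by
  obtain ⟨h1, h2⟩ := abs_le.1 hθ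
  constructor
  simp only [twoPoint, Measure.add_apply, Measure.smul_apply, measure_univ, smul_eq_mul, mul_one]
  rw [← ENNReal.ofReal_add (by linarith) (by linarith)]
  ring_nf; simp

lemma lintegral_twoPoint (b θ : ℝ) {φ : ℝ → ℝ≥0∞} (hφ : Measurable φ) :
    ∫⁻ s, φ s ∂(twoPoint b θ) =
      ENNReal.ofReal ((1 - θ) / 2) * φ b + ENNReal.ofReal ((1 + θ) / 2) * φ (-b) := by
  simp [twoPoint, lintegral_dirac' _ hφ]

lemma ae_twoPoint (b θ : ℝ) : ∀ᵐ s ∂(twoPoint b θ), |s| = |b| := by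
  have hm : MeasurableSet {s : ℝ | |s| = |b|} := measurableSet_eq_fun (by fun_prop) (by fun_prop)
  rw [twoPoint, ae_add_measure_iff]
  constructor <;> exact Measure.ae_smul_measure ((ae_dirac_iff hm).2 (by simp)) _

lemma integral_twoPoint (b : ℝ) {θ : ℝ} (hθ : |θ| ≤ 1) : ∫ s, s ∂(twoPoint b θ) = -(b * θ) := by
  obtain ⟨h1, h2⟩ := abs_le.1 hθ
  have hi : ∀ c : ℝ, Integrable (fun s : ℝ => s) (Measure.dirac c) := fun c =>
    integrable_dirac (by simp)
  rw [twoPoint, integral_add_measure ((hi _).smul_measure (by simp))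
    ((hi _).smul_measure (by simp)), integral_smul_measure, integral_smul_measure,
    integral_dirac, integral_dirac, ENNReal.toReal_ofReal (by linarith),
    ENNReal.toReal_ofReal (by linarith)]
  simp only [smul_eq_mul]; ring

instance (b θ : ℝ) : IsFiniteMeasure (twoPoint b θ) := by
  unfold twoPoint
  have h : ∀ r c : ℝ, IsFiniteMeasure (ENNReal.ofReal r • Measure.dirac c) := fun r c =>
    Measure.smul_finite _ (by simp)
  have := h ((1 - θ) / 2) b
  have := h ((1 + θ) / 2) (-b)
  infer_instance

/-- The product law on `{b, -b}^d` with mean `-(b θ)`. -/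
def noiseLaw (b : ℝ) (θ : Fin d → ℝ) : Measure (Fin d → ℝ) :=
  Measure.pi fun i => twoPoint b (θ i)

instance (b : ℝ) (θ : Fin d → ℝ) : SigmaFinite (noiseLaw b θ) := by
  unfold noiseLaw; infer_instance

lemma isProbabilityMeasure_noiseLaw (b : ℝ) {θ : Fin d → ℝ} (hθ : ∀ i, |θ i| ≤ 1) :
    IsProbabilityMeasure (noiseLaw b θ) := by
  have := fun i => isProbabilityMeasure_twoPoint b (hθ i)
  unfold noiseLaw; infer_instance

lemma measurePreserving_eval_noiseLaw (b : ℝ) {θ : Fin d → ℝ} (hθ : ∀ i, |θ i| ≤ 1) (i : Fin d) :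
    MeasurePreserving (Function.eval i) (noiseLaw b θ) (twoPoint b (θ i)) := by
  have := fun i => isProbabilityMeasure_twoPoint b (hθ i)
  exact measurePreserving_eval _ i

lemma ae_noiseLaw (b : ℝ) {θ : Fin d → ℝ} (hθ : ∀ i, |θ i| ≤ 1) :
    ∀ᵐ ξ ∂(noiseLaw b θ), ∀ i, |ξ i| = |b| :=
  ae_all_iff.2 fun i =>
    (measurePreserving_eval_noiseLaw b hθ i).quasiMeasurePreserving.ae (ae_twoPoint b (θ i))

lemma measurable_shift (α : ℝ) :
    Measurable fun p : X × (Fin d → ℝ) => α • (p.1 : Vec d) + WithLp.toLp 2 p.2 := by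
  fun_prop

/-- The oracle that answers a query at `x` by `α x` plus a noise with the law `noiseLaw b θ`. -/
def biasedOracle (X : Set (Vec d)) (α b : ℝ) (θ : Fin d → ℝ) : Kernel X (Vec d) :=
  (Kernel.id ×ₖ Kernel.const X (noiseLaw b θ)).map
    fun p => α • (p.1 : Vec d) + WithLp.toLp 2 p.2

lemma isMarkovKernel_biasedOracle (X : Set (Vec d)) (α b : ℝ) {θ : Fin d → ℝ}
    (hθ : ∀ i, |θ i| ≤ 1) : IsMarkovKernel (biasedOracle X α b θ) := by
  have := isProbabilityMeasure_noiseLaw b hθ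
  exact Kernel.IsMarkovKernel.map _ (measurable_shift α)

lemma biasedOracle_apply (α b : ℝ) (θ : Fin d → ℝ) (x : X) :
    biasedOracle X α b θ x =
      (noiseLaw b θ).map fun ξ => α • (x : Vec d) + WithLp.toLp 2 ξ := by
  ext s hs
  have hm : Measurable fun ξ : Fin d → ℝ => α • (x : Vec d) + WithLp.toLp 2 ξ := by fun_prop
  rw [← lintegral_indicator_one hs, ← lintegral_indicator_one hs, biasedOracle,
    Kernel.lintegral_map _ (measurable_shift α) _ (measurable_one.indicator hs),
    lintegral_map (measurable_one.indicator hs) hm]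
  exact Kernel.lintegral_id_prod ((measurable_one.indicator hs).comp (measurable_shift α)) _ _

lemma lintegral_biasedOracle_coord (α b : ℝ) {θ : Fin d → ℝ} (hθ : ∀ i, |θ i| ≤ 1) (x : X)
    (i : Fin d) {φ : ℝ → ℝ≥0∞} (hφ : Measurable φ) :
    ∫⁻ g, φ (g i) ∂(biasedOracle X α b θ x) =
      ENNReal.ofReal ((1 - θ i) / 2) * φ (α * x.1 i + b) +
        ENNReal.ofReal ((1 + θ i) / 2) * φ (α * x.1 i - b) := by
  have hφ' : Measurable fun s : ℝ => φ (α * x.1 i + s) := by fun_prop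
  rw [biasedOracle_apply, lintegral_map (by fun_prop) (by fun_prop), sub_eq_add_neg (α * _),
    ← lintegral_twoPoint b (θ i) hφ',
    ← (measurePreserving_eval_noiseLaw b hθ i).lintegral_comp hφ']
  simp

lemma ae_biasedOracle (α b : ℝ) {θ : Fin d → ℝ} (hθ : ∀ i, |θ i| ≤ 1) (x : X) :
    ∀ᵐ g ∂(biasedOracle X α b θ x), ∀ i, |g i - α * x.1 i| = |b| := by
  have hm : MeasurableSet {g : Vec d | ∀ i, |g i - α * x.1 i| = |b|} := by
    simp only [Set.ofPred_forall]
    exact MeasurableSet.iInter fun i => measurableSet_eq_fun (by fun_prop) (by fun_prop)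
  rw [biasedOracle_apply, ae_map_iff (by fun_prop) hm]
  filter_upwards [ae_noiseLaw b hθ] with ξ hξ i
  simpa using hξ i

lemma ae_norm_sq_biasedOracle_le {α b : ℝ} {θ : Fin d → ℝ} (hθ : ∀ i, |θ i| ≤ 1) (x : X)
    (hx : ∀ i, |α * x.1 i| ≤ b) :
    ∀ᵐ g ∂(biasedOracle X α b θ x), ‖g‖ ^ 2 ≤ d * (2 * b) ^ 2 := by
  filter_upwards [ae_biasedOracle α b hθ x] with g hg
  rw [EuclideanSpace.norm_sq_eq]
  calc ∑ i, ‖g i‖ ^ 2 ≤ ∑ _i : Fin d, (2 * b) ^ 2 := by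
        refine Finset.sum_le_sum fun i _ => ?_
        have h0 : 0 ≤ b := (abs_nonneg _).trans (hx i)
        have h1 := hg i
        rw [abs_of_nonneg h0] at h1
        have h2 : ‖g i‖ ≤ 2 * b := by
          rw [Real.norm_eq_abs]
          calc |g i| = |(g i - α * x.1 i) + α * x.1 i| := by ring_nf
            _ ≤ |g i - α * x.1 i| + |α * x.1 i| := abs_add_le _ _
            _ ≤ 2 * b := by linarith [hx i]
        gcongr
    _ = d * (2 * b) ^ 2 := by simp

lemma integral_biasedOracle {α b : ℝ} {θ : Fin d → ℝ} (hθ : ∀ i, |θ i| ≤ 1) (x : X)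
    (hx : ∀ i, |α * x.1 i| ≤ b) :
    ∫ g, g ∂(biasedOracle X α b θ x) = α • (x : Vec d) - b • WithLp.toLp 2 θ := by
  have := isMarkovKernel_biasedOracle X α b hθ
  -- Without integrability the Bochner integral would be 0 by default and would not commute with the
  -- coordinate projections.
  have hint : Integrable (fun g : Vec d => g) (biasedOracle X α b θ x) := by
    refine Integrable.of_bound (by fun_prop) (√(d * (2 * b) ^ 2)) ?_
    filter_upwards [ae_norm_sq_biasedOracle_le hθ x hx] with g hg
    exact Real.le_sqrt_of_sq_le hg
  ext i
  have h := (EuclideanSpace.proj (𝕜 := ℝ) i : Vec d →L[ℝ] ℝ).integral_comp_comm hint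
  change ∫ g : Vec d, g i ∂(biasedOracle X α b θ x) = _ at h
  have hiξ : Integrable (fun ξ : Fin d → ℝ => ξ i) (noiseLaw b θ) := by
    have := isProbabilityMeasure_noiseLaw b hθ
    refine Integrable.of_bound (measurable_pi_apply i).aestronglyMeasurable |b| ?_
    filter_upwards [ae_noiseLaw b hθ] with ξ hξ
    exact (hξ i).le
  refine h.symm.trans ?_
  rw [biasedOracle_apply, integral_map (by fun_prop) (by fun_prop)]
  have := isProbabilityMeasure_noiseLaw b hθ
  simp only [PiLp.add_apply, PiLp.smul_apply, PiLp.sub_apply, smul_eq_mul]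
  rw [integral_add (by fun_prop) hiξ]
  have h2 : ∫ ξ : Fin d → ℝ, ξ i ∂(noiseLaw b θ) = ∫ s, s ∂(twoPoint b (θ i)) := by
    rw [← (measurePreserving_eval_noiseLaw b hθ i).map_eq,
      integral_map (measurable_pi_apply i).aemeasurable (by fun_prop)]
  rw [h2, integral_twoPoint b (hθ i)]
  simp; ring

/-- `α/2 ‖x - c‖²` together with the biased oracle is a member of the class. -/
lemma isStronglyConvexPair_biasedOracle {α b B : ℝ} {θ : Fin d → ℝ} {c : Vec d} (hα : 0 < α)
    (hX : Convex ℝ X) (hθ : ∀ i, |θ i| ≤ 1) (hx : ∀ x ∈ X, ∀ i, |α * x i| ≤ b)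
    (hc : ∀ i, α * c i = b * θ i) (hB : d * (2 * b) ^ 2 ≤ B ^ 2) :
    IsStronglyConvexPair X α B (fun x => α / 2 * ‖x - c‖ ^ 2) (biasedOracle X α b θ) := by
  have hsc : StrongConvexOn X α fun x : Vec d => α / 2 * ‖x - c‖ ^ 2 := by
    rw [strongConvexOn_iff_convex]
    have h : (fun x : Vec d => α / 2 * ‖x - c‖ ^ 2 - α / 2 * ‖x‖ ^ 2) =
        fun x => (innerSL ℝ (-(α • c)) : Vec d →L[ℝ] ℝ) x + α / 2 * ‖c‖ ^ 2 := by
      ext x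
      rw [norm_sub_sq_real]
      simp only [innerSL_apply_apply, inner_neg_left, real_inner_smul_left, real_inner_comm x c]
      ring
    rw [h]
    exact (((innerSL ℝ (-(α • c)) : Vec d →L[ℝ] ℝ).toLinearMap.convexOn hX).add_const _)
  have hθc : b • (WithLp.toLp 2 θ : Vec d) = α • c := by
    ext i; simp [hc i]
  refine ⟨isMarkovKernel_biasedOracle X α b hθ, UniformConvexOn.convexOn hsc fun r => by positivity, hsc, fun x y _ => ?_,
    fun x => ?_⟩
  -- Expanding `‖(y - x) + (x - c)‖²` leaves the slack `α/2 ‖y - x‖² ≥ 0` in the subgradient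
  -- inequality.
  · rw [integral_biasedOracle hθ x (hx x x.2), hθc, ← smul_sub, real_inner_smul_left]
    have h : y - c = (y - x) + (x - c) := by abel
    have h2 := norm_add_sq_real (y - (x : Vec d)) (x - c)
    rw [← h, real_inner_comm] at h2
    rw [h2]
    nlinarith [sq_nonneg ‖y - (x : Vec d)‖, mul_nonneg hα.le (sq_nonneg ‖y - (x : Vec d)‖)]
  · filter_upwards [ae_norm_sq_biasedOracle_le hθ x (hx x x.2)] with g hg
    exact hg.trans hB

/-! ### Likelihood ratios -/

/-- The likelihood ratio of one channel output for the bias `θ` relative to the bias `0`: it only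
involves the sign of the revealed coordinate. -/
def stepLik (θ : Fin d → ℝ) (y : Vec d) : ℝ := ∏ j, (1 - θ j * Real.sign (y j))

/-- The likelihood ratio of a sequence of channel outputs. -/
def pathLik (θ : Fin d → ℝ) {t : ℕ} (h : Fin t → Vec d) : ℝ := ∏ k, stepLik θ (h k)

lemma measurable_real_sign : Measurable Real.sign := by
  unfold Real.sign
  exact Measurable.ite measurableSet_Iio measurable_const
    (Measurable.ite measurableSet_Ioi measurable_const measurable_const)

lemma measurable_stepLik (θ : Fin d → ℝ) : Measurable (stepLik θ) := by
  have := measurable_real_sign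
  unfold stepLik
  fun_prop

lemma measurable_pathLik (θ : Fin d → ℝ) {t : ℕ} :
    Measurable (pathLik θ : (Fin t → Vec d) → ℝ) := by
  have := measurable_stepLik θ
  unfold pathLik
  fun_prop

lemma stepLik_pos {θ : Fin d → ℝ} (hθ : ∀ i, |θ i| < 1) (y : Vec d) : 0 < stepLik θ y := by
  refine Finset.prod_pos fun j _ => ?_
  obtain ⟨h1, h2⟩ := abs_lt.1 (hθ j)
  rcases Real.sign_apply_eq (y j) with h | h | h <;> rw [h] <;> linarith

lemma pathLik_pos {θ : Fin d → ℝ} (hθ : ∀ i, |θ i| < 1) {t : ℕ} (h : Fin t → Vec d) :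
    0 < pathLik θ h :=
  Finset.prod_pos fun _ _ => stepLik_pos hθ _

lemma pathLik_snoc (θ : Fin d → ℝ) {t : ℕ} (h : Fin t → Vec d) (y : Vec d) :
    pathLik θ (Fin.snoc (α := fun _ => Vec d) h y : Fin (t + 1) → Vec d) =
      pathLik θ h * stepLik θ y := by
  simp [pathLik, Fin.prod_univ_castSucc]

/-- Since `Real.sign 0 = 0`, the coordinates that are not revealed contribute the factor 1. -/
lemma stepLik_single (θ : Fin d → ℝ) (i : Fin d) (s : ℝ) :
    stepLik θ (EuclideanSpace.single i s) = 1 - θ i * Real.sign s := by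
  rw [stepLik, Finset.prod_eq_single i]
  · simp
  · intro j _ hj
    simp [hj]
  · simp

lemma stepLik_single_add (θ : Fin d → ℝ) (i : Fin d) {a b : ℝ} (h : |a| < b) :
    stepLik θ (EuclideanSpace.single i (a + b)) = 1 - θ i := by
  rw [stepLik_single, Real.sign_of_pos (by linarith [(abs_lt.1 h).1]), mul_one]

lemma stepLik_single_sub (θ : Fin d → ℝ) (i : Fin d) {a b : ℝ} (h : |a| < b) :
    stepLik θ (EuclideanSpace.single i (a - b)) = 1 + θ i := by
  rw [stepLik_single, Real.sign_of_neg (by linarith [(abs_lt.1 h).2])]; ring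

lemma continuous_single (i : Fin d) :
    Continuous fun s : ℝ => (EuclideanSpace.single i s : Vec d) := by
  have h : (fun s : ℝ => (EuclideanSpace.single i s : Vec d)) =
      fun s => s • (EuclideanSpace.single i (1 : ℝ) : Vec d) := by
    ext s j; simp
  rw [h]; fun_prop

/-- The weights `p` come before `θ`: the same sampling law serves all hypotheses, so it cancels in
the likelihood ratios. -/
lemma exists_lintegral_outputKernel_biasedOracle (α b : ℝ) (A : Algorithm X)
    (S : ChannelStrategy (obliviousChannels d)) (t : ℕ) (ω : A.Ω × (Fin t → Vec d)) :
    ∃ p : Fin d → ℝ, (∀ i, 0 ≤ p i) ∧ ∑ i, p i = 1 ∧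
      ∀ θ : Fin d → ℝ, (∀ i, |θ i| < 1) → ∀ G : Vec d → ℝ≥0∞, Measurable G →
        ∫⁻ y, G y ∂(outputKernel (biasedOracle X α b θ) A S t ω) =
          ∑ i, ENNReal.ofReal (p i) *
            (ENNReal.ofReal ((1 - θ i) / 2) *
                G (EuclideanSpace.single i (α * (A.point t ω).1 i + b)) +
              ENNReal.ofReal ((1 + θ i) / 2) *
                G (EuclideanSpace.single i (α * (A.point t ω).1 i - b))) := by
  obtain ⟨p, hp0, hp1, hp⟩ := exists_lintegral_outputKernel A S t ω
  refine ⟨p, hp0, hp1, fun θ hθ G hG => ?_⟩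
  have hθ' : ∀ i, |θ i| ≤ 1 := fun i => (hθ i).le
  have := isMarkovKernel_biasedOracle X α b hθ'
  rw [hp _ G hG]
  refine Finset.sum_congr rfl fun i _ => ?_
  exact congrArg (ENNReal.ofReal (p i) * ·)
    (lintegral_biasedOracle_coord α b hθ' _ i (hG.comp (continuous_single i).measurable))

variable {α b : ℝ}

/-- As `|α x i| < b`, the two possible values `α x i ± b` have opposite signs, so the ratio of their
probabilities to 1/2 can be read off the output without knowing the query point. -/
lemma lintegral_outputKernel_eq_stepLik (hX : ∀ x ∈ X, ∀ i, |α * x i| < b) (A : Algorithm X)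
    (S : ChannelStrategy (obliviousChannels d)) (t : ℕ) (ω : A.Ω × (Fin t → Vec d))
    {θ : Fin d → ℝ} (hθ : ∀ i, |θ i| < 1) {G : Vec d → ℝ≥0∞} (hG : Measurable G) :
    ∫⁻ y, G y ∂(outputKernel (biasedOracle X α b θ) A S t ω) =
      ∫⁻ y, G y * ENNReal.ofReal (stepLik θ y) ∂(outputKernel (biasedOracle X α b 0) A S t ω) := by
  obtain ⟨p, -, -, hp⟩ := exists_lintegral_outputKernel_biasedOracle α b A S t ω
  have hG' : Measurable fun y => G y * ENNReal.ofReal (stepLik θ y) :=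
    hG.mul (measurable_stepLik θ).ennreal_ofReal
  rw [hp θ hθ G hG, hp 0 (by simp) _ hG']
  refine Finset.sum_congr rfl fun i _ => ?_
  have hx := hX _ (A.point t ω).2 i
  have h2 : (0 : ℝ) ≤ 1 / 2 := by norm_num
  simp only [Pi.zero_apply, sub_zero, add_zero, stepLik_single_add θ i hx,
    stepLik_single_sub θ i hx]
  rw [show (1 - θ i) / 2 = 1 / 2 * (1 - θ i) by ring,
    show (1 + θ i) / 2 = 1 / 2 * (1 + θ i) by ring, ENNReal.ofReal_mul h2, ENNReal.ofReal_mul h2]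
  ring

instance isMarkovKernel_biasedOracle_zero : IsMarkovKernel (biasedOracle X α b 0) :=
  isMarkovKernel_biasedOracle X α b (by simp)

/-- A change of measure to the unbiased oracle, which makes all hypotheses comparable under one law.
The ratios of the successive outputs multiply because each is conditional on the same history. -/
lemma lintegral_transcriptLaw_eq_pathLik (hX : ∀ x ∈ X, ∀ i, |α * x i| < b) (A : Algorithm X)
    (S : ChannelStrategy (obliviousChannels d)) {θ : Fin d → ℝ} (hθ : ∀ i, |θ i| < 1) (t : ℕ)
    {F : A.Ω × (Fin t → Vec d) → ℝ≥0∞} (hF : Measurable F) :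
    ∫⁻ ω, F ω ∂(transcriptLaw (biasedOracle X α b θ) A S t) =
      ∫⁻ ω, F ω * ENNReal.ofReal (pathLik θ ω.2)
        ∂(transcriptLaw (biasedOracle X α b 0) A S t) := by
  have hmk : IsMarkovKernel (biasedOracle X α b θ) :=
    isMarkovKernel_biasedOracle X α b fun i => (hθ i).le
  induction t with
  | zero => simp [transcriptLaw, pathLik]
  | succ t ih =>
    have hL : ∀ t, Measurable fun ω : A.Ω × (Fin t → Vec d) => ENNReal.ofReal (pathLik θ ω.2) :=
      fun t => ((measurable_pathLik θ).comp measurable_snd).ennreal_ofReal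
    have hFL : Measurable fun ω => F ω * ENNReal.ofReal (pathLik θ ω.2) := hF.mul (hL (t + 1))
    rw [lintegral_transcriptLaw_succ _ A S t hF, lintegral_transcriptLaw_succ _ A S t hFL]
    have hFs : Measurable fun p : (A.Ω × (Fin t → Vec d)) × Vec d =>
        F (p.1.1, Fin.snoc (α := fun _ => Vec d) p.1.2 p.2) := hF.comp (measurable_snoc_prod t)
    rw [ih (Measurable.lintegral_kernel_prod_right hFs)]
    refine lintegral_congr fun ω => ?_
    have hFω : Measurable fun y : Vec d => F (ω.1, Fin.snoc (α := fun _ => Vec d) ω.2 y) :=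
      hFs.comp measurable_prodMk_left
    rw [lintegral_outputKernel_eq_stepLik hX A S t ω hθ hFω,
      ← lintegral_mul_const' _ _ ENNReal.ofReal_ne_top]
    refine lintegral_congr fun y => ?_
    rw [pathLik_snoc, ENNReal.ofReal_mul (pathLik_pos hθ _).le]
    ring

lemma lintegral_pathLik (hX : ∀ x ∈ X, ∀ i, |α * x i| < b) (A : Algorithm X)
    (S : ChannelStrategy (obliviousChannels d)) {θ : Fin d → ℝ} (hθ : ∀ i, |θ i| < 1) (t : ℕ) :
    ∫⁻ ω, ENNReal.ofReal (pathLik θ ω.2) ∂(transcriptLaw (biasedOracle X α b 0) A S t) = 1 := by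
  have hmk : IsMarkovKernel (biasedOracle X α b θ) :=
    isMarkovKernel_biasedOracle X α b fun i => (hθ i).le
  have h := lintegral_transcriptLaw_eq_pathLik hX A S hθ t (F := fun _ => 1) measurable_const
  simpa using h.symm

/-! ### The harmonic affinity of two hypotheses that differ in one coordinate -/

/-- The harmonic mean. -/
def harmonicMean (x y : ℝ) : ℝ := 2 * (x * y) / (x + y)

lemma harmonicMean_pos {x y : ℝ} (hx : 0 < x) (hy : 0 < y) : 0 < harmonicMean x y := by
  unfold harmonicMean; positivity

lemma harmonicMean_le {x y : ℝ} (hx : 0 < x) (hy : 0 < y) : harmonicMean x y ≤ 2 * x := by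
  rw [harmonicMean, div_le_iff₀ (by positivity)]
  nlinarith [mul_pos hx hx]

lemma harmonicMean_mul (x y : ℝ) {c : ℝ} (hc : 0 < c) :
    harmonicMean (x * c) (y * c) = harmonicMean x y * c := by
  unfold harmonicMean
  rw [show 2 * (x * c * (y * c)) = 2 * (x * y) * c * c by ring, ← add_mul,
    mul_div_mul_right _ _ hc.ne', mul_div_right_comm]

/-- The two tilted products both equal `(1 - θ²) x y`, and the two tilted sums average to `x + y`;
the rest is the convexity of the reciprocal. -/
lemma harmonicMean_tilt_le {x y θ : ℝ} (hx : 0 < x) (hy : 0 < y) (hθ : |θ| < 1) :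
    (1 - θ ^ 2) * harmonicMean x y ≤
      (harmonicMean (x * (1 - θ)) (y * (1 + θ)) + harmonicMean (x * (1 + θ)) (y * (1 - θ))) / 2 := by
  obtain ⟨h1, h2⟩ := abs_lt.1 hθ
  have hp : 0 < 1 + θ := by linarith
  have hm : 0 < 1 - θ := by linarith
  unfold harmonicMean
  set u := x * (1 - θ) + y * (1 + θ) with hu
  set w := x * (1 + θ) + y * (1 - θ) with hw
  have hu0 : 0 < u := by positivity
  have hw0 : 0 < w := by positivity
  have hs : x + y = (u + w) / 2 := by rw [hu, hw]; ring
  have key : 1 / ((u + w) / 2) ≤ (1 / u + 1 / w) / 2 := by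
    rw [div_add_div _ _ hu0.ne' hw0.ne', div_div, div_le_div_iff₀ (by positivity) (by positivity)]
    nlinarith [sq_nonneg (u - w)]
  have hc : 0 ≤ (1 - θ ^ 2) * (2 * (x * y)) := by
    have : 0 < 1 - θ ^ 2 := by nlinarith
    positivity
  have := mul_le_mul_of_nonneg_left key hc
  rw [hs]
  calc (1 - θ ^ 2) * (2 * (x * y) / ((u + w) / 2))
      = (1 - θ ^ 2) * (2 * (x * y)) * (1 / ((u + w) / 2)) := by ring
    _ ≤ _ := this
    _ = _ := by ring

/-- After clearing the denominator, the difference of the two sides is `(x a + y c)²`. The harmonic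
mean is thus the exact minimal weighted squared loss when `a - c` is prescribed. -/
lemma sq_mul_harmonicMean_le {x y : ℝ} (hx : 0 < x) (hy : 0 < y) (a c : ℝ) :
    (a - c) ^ 2 / 2 * harmonicMean x y ≤ a ^ 2 * x + c ^ 2 * y := by
  rw [harmonicMean, ← mul_div_assoc, div_le_iff₀ (by positivity)]
  nlinarith [sq_nonneg (x * a + y * c)]

/-- The bias with the sign of its coordinate `i` reversed. -/
def flip (θ : Fin d → ℝ) (i : Fin d) : Fin d → ℝ := Function.update θ i (-θ i)

lemma abs_flip_lt {θ : Fin d → ℝ} (hθ : ∀ i, |θ i| < 1) (i j : Fin d) : |flip θ i j| < 1 := by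
  by_cases h : j = i
  · subst h; simpa [flip] using hθ j
  · simpa [flip, h] using hθ j

/-- The harmonic mean of the likelihood ratios of `θ` and `flip θ i`. -/
def affinity (θ : Fin d → ℝ) (i : Fin d) {t : ℕ} (h : Fin t → Vec d) : ℝ :=
  harmonicMean (pathLik θ h) (pathLik (flip θ i) h)

lemma affinity_pos {θ : Fin d → ℝ} (hθ : ∀ i, |θ i| < 1) (i : Fin d) {t : ℕ}
    (h : Fin t → Vec d) : 0 < affinity θ i h :=
  harmonicMean_pos (pathLik_pos hθ h) (pathLik_pos (abs_flip_lt hθ i) h)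

lemma measurable_affinity (θ : Fin d → ℝ) (i : Fin d) {t : ℕ} :
    Measurable (affinity θ i : (Fin t → Vec d) → ℝ) := by
  have h1 := measurable_pathLik (t := t) θ
  have h2 := measurable_pathLik (t := t) (flip θ i)
  unfold affinity harmonicMean
  fun_prop

/-- An output at `j ≠ i` multiplies both ratios by the same factor, and the factors `1 - θ j` and `1
+ θ j` average to 1. Only an output at `i` tilts the ratios in opposite directions. -/
lemma le_affinity_snoc {θ : Fin d → ℝ} (hθ : ∀ i, |θ i| < 1) {a b : ℝ} (hab : |a| < b)
    (i j : Fin d) {t : ℕ} (h : Fin t → Vec d) :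
    affinity θ i h - (if j = i then θ i ^ 2 * affinity θ i h else 0) ≤
      1 / 2 * affinity θ i (Fin.snoc (α := fun _ => Vec d) h
          (EuclideanSpace.single j (a + b)) : Fin (t + 1) → Vec d) +
        1 / 2 * affinity θ i (Fin.snoc (α := fun _ => Vec d) h
          (EuclideanSpace.single j (a - b)) : Fin (t + 1) → Vec d) := by
  unfold affinity
  simp only [pathLik_snoc, stepLik_single_add _ _ hab, stepLik_single_sub _ _ hab]
  have hL := pathLik_pos hθ h
  have hL' := pathLik_pos (abs_flip_lt hθ i) h
  by_cases hj : j = i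
  · subst hj
    have := harmonicMean_tilt_le hL hL' (hθ j)
    simp only [if_true, flip, Function.update_self] at this ⊢
    rw [sub_neg_eq_add, ← sub_eq_add_neg]
    linarith
  · obtain ⟨h1, h2⟩ := abs_lt.1 (hθ j)
    have hf : flip θ i j = θ j := by simp [flip, hj]
    rw [if_neg hj, hf, harmonicMean_mul _ _ (by linarith), harmonicMean_mul _ _ (by linarith)]
    linarith

/-- The bound is on the sum because `p` depends on the history and only `∑ i, p i = 1` is known. The
loss is charged to `pathLik θ`, which is common to all `i` and has reference integral 1. -/
lemma sum_affinity_le (hX : ∀ x ∈ X, ∀ i, |α * x i| < b) (A : Algorithm X)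
    (S : ChannelStrategy (obliviousChannels d)) {θ : Fin d → ℝ} (hθ : ∀ i, |θ i| < 1) {η : ℝ}
    (hη : ∀ i, θ i ^ 2 ≤ η) (hη0 : 0 ≤ η) (t : ℕ) (ω : A.Ω × (Fin t → Vec d)) :
    ∑ i, ENNReal.ofReal (affinity θ i ω.2) ≤
      ∑ i, ∫⁻ y, ENNReal.ofReal (affinity θ i
          (Fin.snoc (α := fun _ => Vec d) ω.2 y : Fin (t + 1) → Vec d))
        ∂(outputKernel (biasedOracle X α b 0) A S t ω) +
      ENNReal.ofReal (2 * η) * ENNReal.ofReal (pathLik θ ω.2) := by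
  obtain ⟨p, hp0, hp1, hp⟩ := exists_lintegral_outputKernel_biasedOracle α b A S t ω
  have hL := pathLik_pos hθ ω.2
  have hH := fun i => (affinity_pos hθ i ω.2)
  have hθ2 : ∀ i, θ i ^ 2 ≤ 1 := fun i => by
    rw [← sq_abs]; exact pow_le_one₀ (abs_nonneg _) (hθ i).le
  have hp1' : ∀ i, p i ≤ 1 := fun i => by
    rw [← hp1]; exact Finset.single_le_sum (fun j _ => hp0 j) (Finset.mem_univ i)
  have hstep : ∀ i, ENNReal.ofReal (affinity θ i ω.2 - p i * (θ i ^ 2 * affinity θ i ω.2)) ≤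
      ∫⁻ y, ENNReal.ofReal (affinity θ i
          (Fin.snoc (α := fun _ => Vec d) ω.2 y : Fin (t + 1) → Vec d))
        ∂(outputKernel (biasedOracle X α b 0) A S t ω) := fun i => by
    have hm : Measurable fun y : Vec d => ENNReal.ofReal (affinity θ i
        (Fin.snoc (α := fun _ => Vec d) ω.2 y : Fin (t + 1) → Vec d)) :=
      ((measurable_affinity θ i).comp (measurable_snd.comp ((measurable_snoc_prod t).comp
        (measurable_prodMk_left (x := ω))))).ennreal_ofReal
    rw [hp 0 (by simp) _ hm]
    have hsum : affinity θ i ω.2 - p i * (θ i ^ 2 * affinity θ i ω.2) =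
        ∑ j, p j * (affinity θ i ω.2 - (if j = i then θ i ^ 2 * affinity θ i ω.2 else 0)) := by
      simp [mul_sub, Finset.sum_sub_distrib, ← Finset.sum_mul, hp1]
    have hnn : ∀ j, 0 ≤ affinity θ i ω.2 - (if j = i then θ i ^ 2 * affinity θ i ω.2 else 0) :=
      fun j => by
        split_ifs
        · nlinarith [hH i, hθ2 i]
        · linarith [hH i]
    rw [hsum, ENNReal.ofReal_sum_of_nonneg fun j _ => mul_nonneg (hp0 j) (hnn j)]
    refine Finset.sum_le_sum fun j _ => ?_
    rw [ENNReal.ofReal_mul (hp0 j)]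
    gcongr
    refine (ENNReal.ofReal_le_ofReal
      (le_affinity_snoc hθ (hX _ (A.point t ω).2 j) i j ω.2)).trans ?_
    have h2 : (0 : ℝ) ≤ 1 / 2 := by norm_num
    refine ENNReal.ofReal_add_le.trans ?_
    rw [ENNReal.ofReal_mul h2, ENNReal.ofReal_mul h2]
    simp
  refine le_trans ?_ (add_le_add_left (Finset.sum_le_sum fun i _ => hstep i) _)
  have hnn : ∀ i, 0 ≤ affinity θ i ω.2 - p i * (θ i ^ 2 * affinity θ i ω.2) := fun i => by
    have h1 : p i * θ i ^ 2 ≤ 1 := mul_le_one₀ (hp1' i) (sq_nonneg _) (hθ2 i)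
    nlinarith [hH i]
  rw [← ENNReal.ofReal_sum_of_nonneg fun i _ => (hH i).le,
    ← ENNReal.ofReal_sum_of_nonneg fun i _ => hnn i, ← ENNReal.ofReal_mul (by linarith),
    ← ENNReal.ofReal_add (Finset.sum_nonneg fun i _ => hnn i) (by positivity)]
  refine ENNReal.ofReal_le_ofReal ?_
  rw [Finset.sum_sub_distrib]
  have : ∑ i, p i * (θ i ^ 2 * affinity θ i ω.2) ≤ ∑ i, p i * (2 * η * pathLik θ ω.2) := by
    refine Finset.sum_le_sum fun i _ => mul_le_mul_of_nonneg_left ?_ (hp0 i)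
    calc θ i ^ 2 * affinity θ i ω.2 ≤ η * (2 * pathLik θ ω.2) :=
          mul_le_mul (hη i) (harmonicMean_le hL (pathLik_pos (abs_flip_lt hθ i) _)) (hH i).le hη0
      _ = 2 * η * pathLik θ ω.2 := by ring
  rw [← Finset.sum_mul, hp1, one_mul] at this
  linarith

/-- Each query decreases the total affinity by at most `2 η`, whichever coordinate is revealed. -/
lemma card_le_sum_affinity (hX : ∀ x ∈ X, ∀ i, |α * x i| < b) (A : Algorithm X)
    (S : ChannelStrategy (obliviousChannels d)) {θ : Fin d → ℝ} (hθ : ∀ i, |θ i| < 1) {η : ℝ}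
    (hη : ∀ i, θ i ^ 2 ≤ η) (hη0 : 0 ≤ η) (t : ℕ) :
    (d : ℝ≥0∞) ≤ ∑ i, ∫⁻ ω, ENNReal.ofReal (affinity θ i ω.2)
        ∂(transcriptLaw (biasedOracle X α b 0) A S t) + t * ENNReal.ofReal (2 * η) := by
  have hm : ∀ (t : ℕ) (i : Fin d),
      Measurable fun ω : A.Ω × (Fin t → Vec d) => ENNReal.ofReal (affinity θ i ω.2) :=
    fun t i => ((measurable_affinity θ i).comp measurable_snd).ennreal_ofReal
  induction t with
  | zero =>
    -- Before any output the ratios are empty products, so each affinity is 1 and the total is `d`.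
    have h : ∀ (i : Fin d) (h : Fin 0 → Vec d), affinity θ i h = 1 := fun i h => by
      norm_num [affinity, pathLik, harmonicMean]
    simp [h]
  | succ t ih =>
    refine ih.trans ?_
    have hk : ∀ i, Measurable fun ω : A.Ω × (Fin t → Vec d) =>
        ∫⁻ y, ENNReal.ofReal (affinity θ i
          (Fin.snoc (α := fun _ => Vec d) ω.2 y : Fin (t + 1) → Vec d))
        ∂(outputKernel (biasedOracle X α b 0) A S t ω) := fun i => by
      have hs : Measurable fun q : (A.Ω × (Fin t → Vec d)) × Vec d => ENNReal.ofReal (affinity θ i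
          (Fin.snoc (α := fun _ => Vec d) q.1.2 q.2 : Fin (t + 1) → Vec d)) :=
        ((measurable_affinity θ i).comp
          (measurable_snd.comp (measurable_snoc_prod t))).ennreal_ofReal
      exact Measurable.lintegral_kernel_prod_right hs
    have hL : Measurable fun ω : A.Ω × (Fin t → Vec d) => ENNReal.ofReal (pathLik θ ω.2) :=
      ((measurable_pathLik θ).comp measurable_snd).ennreal_ofReal
    have hle := lintegral_mono (μ := transcriptLaw (biasedOracle X α b 0) A S t)
      fun ω => sum_affinity_le hX A S hθ hη hη0 t ω
    rw [lintegral_add_right _ (hL.const_mul _), lintegral_const_mul _ hL,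
      lintegral_pathLik hX A S hθ t, mul_one, lintegral_finsetSum _ fun i _ => hm t i,
      lintegral_finsetSum _ fun i _ => hk i] at hle
    refine (add_le_add_left hle _).trans (le_of_eq ?_)
    have hsucc : ∀ i, _ = _ := fun i =>
      lintegral_transcriptLaw_succ (biasedOracle X α b 0) A S t (hm (t + 1) i)
    rw [Finset.sum_congr rfl fun i _ => hsucc i, Nat.cast_add, Nat.cast_one, add_mul, one_mul,
      add_assoc, add_comm (ENNReal.ofReal (2 * η))]

/-- The two-point bound: no point is close to both `δ` and `-δ`. -/
lemma affinity_le_lintegral_add (hX : ∀ x ∈ X, ∀ i, |α * x i| < b) (A : Algorithm X)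
    (S : ChannelStrategy (obliviousChannels d)) {θ : Fin d → ℝ} (hθ : ∀ i, |θ i| < 1) (i : Fin d)
    (t : ℕ) (δ : ℝ) :
    ENNReal.ofReal (2 * δ ^ 2) * ∫⁻ ω, ENNReal.ofReal (affinity θ i ω.2)
        ∂(transcriptLaw (biasedOracle X α b 0) A S t) ≤
      ∫⁻ ω, ENNReal.ofReal (((A.point t ω).1 i - δ) ^ 2)
          ∂(transcriptLaw (biasedOracle X α b θ) A S t) +
        ∫⁻ ω, ENNReal.ofReal (((A.point t ω).1 i + δ) ^ 2)
          ∂(transcriptLaw (biasedOracle X α b (flip θ i)) A S t) := by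
  have hpt : Measurable fun ω => (A.point t ω).1 i := by
    have := A.measurable_point t
    fun_prop
  have hL : ∀ θ : Fin d → ℝ,
      Measurable fun ω : A.Ω × (Fin t → Vec d) => ENNReal.ofReal (pathLik θ ω.2) :=
    fun θ => ((measurable_pathLik θ).comp measurable_snd).ennreal_ofReal
  have hmm : Measurable fun ω => ENNReal.ofReal (((A.point t ω).1 i - δ) ^ 2) :=
    ((hpt.sub_const δ).pow_const 2).ennreal_ofReal
  have hmp : Measurable fun ω => ENNReal.ofReal (((A.point t ω).1 i + δ) ^ 2) :=
    ((hpt.add_const δ).pow_const 2).ennreal_ofReal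
  have hmL : Measurable fun ω =>
      ENNReal.ofReal (((A.point t ω).1 i - δ) ^ 2) * ENNReal.ofReal (pathLik θ ω.2) :=
    hmm.mul (hL θ)
  rw [lintegral_transcriptLaw_eq_pathLik hX A S hθ t hmm,
    lintegral_transcriptLaw_eq_pathLik hX A S (abs_flip_lt hθ i) t hmp,
    ← lintegral_add_left hmL, ← lintegral_const_mul' _ _ ENNReal.ofReal_ne_top]
  refine lintegral_mono fun ω => ?_
  rw [← ENNReal.ofReal_mul (by positivity), ← ENNReal.ofReal_mul (by positivity),
    ← ENNReal.ofReal_mul (by positivity), ← ENNReal.ofReal_add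
      (mul_nonneg (sq_nonneg _) (pathLik_pos hθ _).le)
      (mul_nonneg (sq_nonneg _) (pathLik_pos (abs_flip_lt hθ i) _).le)]
  refine ENNReal.ofReal_le_ofReal ?_
  -- The errors at the two hypotheses differ by `2 δ`, and `(2 δ)² / 2 = 2 δ²`.
  refine le_trans (le_of_eq ?_) (sq_mul_harmonicMean_le (pathLik_pos hθ ω.2)
    (pathLik_pos (abs_flip_lt hθ i) ω.2) _ _)
  rw [affinity]
  ring

/-! ### The average over the hypercube -/

/-- The vector of signs `v`, multiplied by `c`. -/
def scaledSigns (c : ℝ) (v : Fin d → ℤˣ) : Fin d → ℝ := fun i => c * ((v i : ℤ) : ℝ)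

lemma abs_scaledSigns (c : ℝ) (v : Fin d → ℤˣ) (i : Fin d) : |scaledSigns c v i| = |c| := by
  rcases Int.units_eq_one_or (v i) with h | h <;> simp [scaledSigns, h]

lemma scaledSigns_sq (c : ℝ) (v : Fin d → ℤˣ) (i : Fin d) : scaledSigns c v i ^ 2 = c ^ 2 := by
  rw [← sq_abs, abs_scaledSigns, sq_abs]

lemma scaledSigns_mul_mulSingle (c : ℝ) (v : Fin d → ℤˣ) (i : Fin d) :
    scaledSigns c (v * Pi.mulSingle i (-1)) = flip (scaledSigns c v) i := by
  ext j
  by_cases h : j = i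
  · subst h; simp [scaledSigns, flip]
  · simp [scaledSigns, flip, h]

/-- The worst case over `v` dominates the average, and reversing the sign `i` permutes the
hypercube. Each coordinate error therefore occurs twice in the sum of the two-point bounds. -/
lemma le_of_forall_sum_lintegral_le {α b η δ : ℝ} (hX : ∀ x ∈ X, ∀ i, |α * x i| < b)
    (A : Algorithm X) (S : ChannelStrategy (obliviousChannels d)) (hη : |η| < 1) {T : ℕ}
    (hT : 4 * (T * η ^ 2) ≤ d) {R : ℝ≥0∞}
    (hR : ∀ v : Fin d → ℤˣ,
      ∑ i, ∫⁻ ω, ENNReal.ofReal (((A.point T ω).1 i - scaledSigns δ v i) ^ 2)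
        ∂(transcriptLaw (biasedOracle X α b (scaledSigns η v)) A S T) ≤ R) :
    ENNReal.ofReal (d * δ ^ 2 / 2) ≤ R := by
  set e : (Fin d → ℤˣ) → Fin d → ℝ≥0∞ := fun v i =>
    ∫⁻ ω, ENNReal.ofReal (((A.point T ω).1 i - scaledSigns δ v i) ^ 2)
      ∂(transcriptLaw (biasedOracle X α b (scaledSigns η v)) A S T) with he
  have hθ : ∀ (v : Fin d → ℤˣ) i, |scaledSigns η v i| < 1 := fun v i => by
    rwa [abs_scaledSigns]
  have hpair : ∀ v : Fin d → ℤˣ,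
      ENNReal.ofReal (d * δ ^ 2) ≤ ∑ i, (e v i + e (v * Pi.mulSingle i (-1)) i) := fun v => by
    have h1 := card_le_sum_affinity hX A S (hθ v) (fun i => (scaledSigns_sq η v i).le)
      (sq_nonneg η) T
    rw [← ENNReal.ofReal_natCast T, ← ENNReal.ofReal_mul (by positivity)] at h1
    have h2 : ENNReal.ofReal (d / 2) ≤ ∑ i, ∫⁻ ω, ENNReal.ofReal (affinity (scaledSigns η v) i ω.2)
        ∂(transcriptLaw (biasedOracle X α b 0) A S T) := by
      refine le_trans ?_ (tsub_le_iff_right.2 h1)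
      rw [← ENNReal.ofReal_natCast d, ← ENNReal.ofReal_sub _ (by positivity)]
      exact ENNReal.ofReal_le_ofReal (by linarith)
    calc ENNReal.ofReal (d * δ ^ 2) = ENNReal.ofReal (2 * δ ^ 2) * ENNReal.ofReal (d / 2) := by
          rw [← ENNReal.ofReal_mul (by positivity)]; ring_nf
      _ ≤ _ := mul_le_mul_right h2 _
      _ ≤ _ := by
          rw [Finset.mul_sum]
          refine Finset.sum_le_sum fun i _ => ?_
          -- The two-point bound is applied with the signed offset `δ v i`, so that its second term
          -- is the error at the reversed sign.
          have h3 := affinity_le_lintegral_add hX A S (hθ v) i T (scaledSigns δ v i)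
          rw [scaledSigns_sq] at h3
          refine h3.trans (le_of_eq ?_)
          simp only [he, scaledSigns_mul_mulSingle]
          simp [flip]
  have hflip : ∀ i, ∑ v : Fin d → ℤˣ, e (v * Pi.mulSingle i (-1)) i = ∑ v, e v i := fun i =>
    Equiv.sum_comp (Equiv.mulRight (Pi.mulSingle i (-1))) fun v => e v i
  have hsum : ∑ _v : Fin d → ℤˣ, ENNReal.ofReal (d * δ ^ 2) ≤ ∑ _v : Fin d → ℤˣ, 2 * R := by
    refine (Finset.sum_le_sum fun v _ => hpair v).trans ?_
    rw [Finset.sum_comm]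
    simp only [Finset.sum_add_distrib, hflip]
    rw [← two_mul, Finset.sum_comm, ← Finset.mul_sum]
    exact mul_le_mul_right (Finset.sum_le_sum fun v _ => hR v) _
  simp only [Finset.sum_const, nsmul_eq_mul] at hsum
  have h := (ENNReal.mul_le_mul_iff_right (by simp) (by simp)).1 hsum
  rw [show (d * δ ^ 2 : ℝ) = 2 * (d * δ ^ 2 / 2) by ring, ENNReal.ofReal_mul (by norm_num),
    ENNReal.ofReal_ofNat] at h
  exact (ENNReal.mul_le_mul_iff_right (by simp) (by simp)).1 h

/-! ### The box -/

/-- The box `[-r, r]^d`. -/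
def box (d : ℕ) (r : ℝ) : Set (Vec d) := {x | ∀ i, |x i| ≤ r}

lemma convex_box (r : ℝ) : Convex ℝ (box d r) := by
  intro x hx y hy a c ha hc hac i
  calc |a * x i + c * y i| ≤ |a * x i| + |c * y i| := abs_add_le _ _
    _ = a * |x i| + c * |y i| := by rw [abs_mul, abs_mul, abs_of_nonneg ha, abs_of_nonneg hc]
    _ ≤ a * r + c * r := by gcongr; exacts [hx i, hy i]
    _ = r := by rw [← add_mul, hac, one_mul]

lemma box_mem_domains {r D : ℝ} (hr : 0 ≤ r) (hD : 0 ≤ D) (h : d * (2 * r) ^ 2 ≤ D ^ 2) :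
    box d r ∈ domains d D := by
  refine ⟨⟨0, fun i => by simpa using hr⟩, ?_, convex_box r, fun x hx y hy => ?_⟩
  · simp only [box, Set.ofPred_forall]
    exact isClosed_iInter fun i => isClosed_le (by fun_prop) continuous_const
  · refine abs_le_of_sq_le_sq' ?_ hD |>.2
    refine le_trans ?_ h
    rw [EuclideanSpace.norm_sq_eq]
    calc ∑ i, ‖(x - y) i‖ ^ 2 ≤ ∑ _i : Fin d, (2 * r) ^ 2 := by
          refine Finset.sum_le_sum fun i _ => ?_
          have : ‖(x - y) i‖ ≤ 2 * r := by
            rw [PiLp.sub_apply, Real.norm_eq_abs]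
            linarith [abs_sub (x i) (y i), hx i, hy i]
          gcongr
      _ = d * (2 * r) ^ 2 := by simp

lemma sum_lintegral_le_optError {α : ℝ} (hα : 0 < α) {c : Fin d → ℝ} (hc : WithLp.toLp 2 c ∈ X)
    (O : Kernel X (Vec d)) (A : Algorithm X) (S : ChannelStrategy (obliviousChannels d)) (T : ℕ) :
    ENNReal.ofReal (α / 2) *
        ∑ i, ∫⁻ ω, ENNReal.ofReal (((A.point T ω).1 i - c i) ^ 2) ∂(transcriptLaw O A S T) ≤
      optError (fun x => α / 2 * ‖x - WithLp.toLp 2 c‖ ^ 2) O A S T := by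
  have hm : ∀ i, Measurable fun ω => ENNReal.ofReal (((A.point T ω).1 i - c i) ^ 2) := fun i => by
    have hpt : Measurable fun ω => (A.point T ω).1 i := by
      have := A.measurable_point T
      fun_prop
    exact ((hpt.sub_const _).pow_const 2).ennreal_ofReal
  rw [← lintegral_finsetSum _ fun i _ => hm i, ← lintegral_const_mul' _ _ ENNReal.ofReal_ne_top]
  refine lintegral_mono fun ω => ?_
  rw [← ENNReal.ofReal_sum_of_nonneg fun i _ => sq_nonneg _, ← ENNReal.ofReal_mul (by positivity)]
  refine ENNReal.ofReal_le_ofReal ?_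
  -- The centre lies in `X`, so the infimum is at most 0 and subtracting it can only increase the
  -- gap.
  have hinf : ⨅ x : X, α / 2 * ‖(x : Vec d) - WithLp.toLp 2 c‖ ^ 2 ≤ 0 :=
    (ciInf_le ⟨0, by rintro _ ⟨x, rfl⟩; positivity⟩ (⟨_, hc⟩ : X)).trans (by simp)
  beta_reduce
  rw [EuclideanSpace.norm_sq_eq]
  simp only [PiLp.sub_apply, Real.norm_eq_abs, sq_abs]
  linarith

lemma le_adaptiveMinmaxError_box {α b B r η δ : ℝ} {T : ℕ} (hα : 0 < α) (hr : α * r < b)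
    (hδ : 0 ≤ δ) (hδr : δ ≤ r) (hη : α * δ = b * η) (hη0 : 0 ≤ η) (hη1 : η < 1)
    (hB : d * (2 * b) ^ 2 ≤ B ^ 2) (hT : 4 * (T * η ^ 2) ≤ d) :
    ENNReal.ofReal (α * (d * δ ^ 2) / 4) ≤
      adaptiveMinmaxError (box d r) (stronglyConvexClass (box d r) α B) T
        (obliviousChannels d) := by
  have hX : ∀ x ∈ box d r, ∀ i, |α * x i| < b := fun x hx i => by
    rw [abs_mul, abs_of_pos hα]
    exact (mul_le_mul_of_nonneg_left (hx i) hα.le).trans_lt hr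
  refine le_iInf₂ fun A S => ?_
  set R := ⨆ fO ∈ stronglyConvexClass (box d r) α B, optError fO.1 fO.2 A S T
  have hα2 : ENNReal.ofReal (α / 2) ≠ 0 := by simpa using hα
  rw [show α * (d * δ ^ 2) / 4 = α / 2 * (d * δ ^ 2 / 2) by ring,
    ENNReal.ofReal_mul (by positivity), mul_comm,
    ← ENNReal.le_div_iff_mul_le (Or.inl hα2) (Or.inl ENNReal.ofReal_ne_top)]
  have hη' : |η| < 1 := by rwa [abs_of_nonneg hη0]
  refine le_of_forall_sum_lintegral_le hX A S hη' hT fun v => ?_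
  rw [ENNReal.le_div_iff_mul_le (Or.inl hα2) (Or.inl ENNReal.ofReal_ne_top), mul_comm]
  have hc : (WithLp.toLp 2 (scaledSigns δ v) : Vec d) ∈ box d r := fun i => by
    change |scaledSigns δ v i| ≤ r
    rwa [abs_scaledSigns, abs_of_nonneg hδ]
  refine (sum_lintegral_le_optError hα hc _ A S T).trans ?_
  refine le_iSup₂_of_le (f := fun fO (_ : fO ∈ stronglyConvexClass (box d r) α B) =>
    optError fO.1 fO.2 A S T) (_, biasedOracle (box d r) α b (scaledSigns η v)) ?_ le_rfl
  refine isStronglyConvexPair_biasedOracle hα (convex_box r)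
    (fun i => by rw [abs_scaledSigns]; exact hη'.le) (fun x hx i => (hX x hx i).le)
    (fun i => ?_) hB
  simp only [scaledSigns]
  rw [← mul_assoc, ← mul_assoc, hη]

end ConstrainedOpt

end

/-! ### The choice of the parameters. -/

theorem theoremt :
    ∃ c₀ > (0 : ℝ), ∃ c₁ > (0 : ℝ), ∀ (d : ℕ) (D B α : ℝ) (T : ℕ),
      1 ≤ d → 0 < D → 0 < B → 0 < α → D / 8 ≤ B / α →
      c₀ * (d * B ^ 2 / (α ^ 2 * D ^ 2)) ≤ T →
      ENNReal.ofReal (c₁ * (d * B ^ 2 / (α * T))) ≤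
        ⨆ X ∈ ConstrainedOpt.domains d D,
          ConstrainedOpt.adaptiveMinmaxError X (ConstrainedOpt.stronglyConvexClass X α B) T
            (ConstrainedOpt.obliviousChannels d) := by
  refine ⟨64, by norm_num, 1 / 64, by norm_num, fun d D B α T hd hD hB hα hDB hT => ?_⟩
  have hd0 : (0 : ℝ) < d := by exact_mod_cast hd
  have hT0 : (0 : ℝ) < T := lt_of_lt_of_le (by positivity) hT
  have hDB' : D * α ≤ 8 * B := by
    rw [div_le_div_iff₀ (by norm_num) hα] at hDB; linarith
  have hT' : 64 * (d * B ^ 2) ≤ T * (α ^ 2 * D ^ 2) := by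
    rwa [← mul_div_assoc, div_le_iff₀ (by positivity)] at hT
  -- The condition on `B / α` enters here: with the lower bound on `T` it gives `d ≤ T`, hence `η ≤
  -- 1/2` below.
  have hdT : (d : ℝ) ≤ T := by
    have h1 : (D * α) ^ 2 ≤ (8 * B) ^ 2 := by gcongr
    have h2 : T * (D * α) ^ 2 ≤ T * (8 * B) ^ 2 := by gcongr
    have h3 : d * (64 * B ^ 2) ≤ T * (64 * B ^ 2) := by nlinarith
    exact le_of_mul_le_mul_right h3 (by positivity)
  set s := √(d : ℝ) with hs
  set u := √(T : ℝ) with hu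
  have hs0 : 0 < s := Real.sqrt_pos.2 hd0
  have hu0 : 0 < u := Real.sqrt_pos.2 hT0
  have hs2 : s ^ 2 = d := Real.sq_sqrt hd0.le
  have hu2 : u ^ 2 = T := Real.sq_sqrt hT0.le
  have hsu : s ≤ u := Real.sqrt_le_sqrt hdT
  have hsB : 8 * (s * B) ≤ u * (α * D) := by
    refine abs_le_of_sq_le_sq' ?_ (by positivity) |>.2
    calc (8 * (s * B)) ^ 2 = 64 * (s ^ 2 * B ^ 2) := by ring
      _ ≤ u ^ 2 * (α ^ 2 * D ^ 2) := by rw [hs2, hu2]; exact hT'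
      _ = (u * (α * D)) ^ 2 := by ring
  -- The half-width must be at least `δ`, which can be as large as `D / (32 s)` when `T` is
  -- smallest, and below `b / α`, which is at least `D / (16 s)`.
  have hbox : ConstrainedOpt.box d (D / (32 * s)) ∈ ConstrainedOpt.domains d D := by
    refine ConstrainedOpt.box_mem_domains (by positivity) hD.le ?_
    rw [← hs2]
    have : s ^ 2 * (2 * (D / (32 * s))) ^ 2 = D ^ 2 / 256 := by field_simp; norm_num
    rw [this]; nlinarith [sq_nonneg D]
  -- The value of `b` makes `d (2 b)² = B²`, that of `η` makes `4 T η² = d`, and `δ = b η / α`. Then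
  -- `α d δ² / 4 = d B² / (64 α T)`.
  refine le_trans ?_ (le_iSup₂_of_le _ hbox
    (ConstrainedOpt.le_adaptiveMinmaxError_box (b := B / (2 * s)) (η := s / (2 * u))
      (δ := B / (4 * (α * u))) hα ?_ (by positivity) ?_ ?_ (by positivity) ?_ ?_ ?_))
  · refine ENNReal.ofReal_le_ofReal (le_of_eq ?_)
    rw [← hu2]; field_simp; norm_num
  · rw [← mul_div_assoc, div_lt_div_iff₀ (by positivity) (by positivity)]
    nlinarith [mul_pos hB hs0]
  · rw [div_le_div_iff₀ (by positivity) (by positivity)]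
    nlinarith
  · field_simp; norm_num
  · rw [div_lt_one (by positivity)]; linarith
  · rw [← hs2]
    refine le_of_eq ?_
    field_simp
  · rw [← hs2, ← hu2]
    refine le_of_eq ?_
    field_simp; norm_num
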